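/- **Setting.** An instance is a connected graph $G$ with $n\ge 1$ nodes, in which the nodes carry pairwise distinct identities that are positive integers, together with an input $x(v)\in\mathbb N$ at each node. A labelling of an instance assigns a bit string to each node; it has size at most $s$ if each of these strings has length at most $s$. A local algorithm with running time $t$ is a computable function $A$ from labelled neighbourhoods to $\{\text{accept},\text{reject}\}$; node $v$ applies it to the subgraph $B_G(v,t)$ induced by the nodes at distance at most $t$ from $v$, including the identities, inputs and labels of these nodes. $A$ accepts if every node accepts. Let $\mathcal C$ be a class of instances and $L$ a language (a set of instances). For $k\ge 0$, $L$ is in $\Sigma_k$ over $\mathcal C$ if there are a real $c\ge 0$, an integer $t\ge 0$ and a local algorithm $A$ with running time $t$ such that for every instance $I\in\mathcal C$, with $n$ nodes, $$I\in L\iff \exists \ell_1\,\forall \ell_2\,\exists\ell_3\cdots Q\ell_k:\ A(I,\ell_1,\dots,\ell_k)\text{ accepts},$$ where the quantifiers alternate and range over the labellings of size at most $c\log_2 n$. $\Pi_k$ over $\mathcal C$ is defined in the same way with a universal first quantifier. Put $\Lambda_k=\Sigma_k$ for odd $k$, $\Lambda_k=\Pi_k$ for even $k$, and $\mathsf{LH}=\bigcup_{k\ge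 0}\Lambda_k$. A 0/1-labelled oriented path is an instance in which the nodes have the identities $1,\dots,n$, the nodes $i$ and $j$ are adjacent if and only if $|i-j|=1$, and all inputs are $0$ or $1$; reading the inputs in the order of the identities gives a word $w\in\{0,1\}^n$. A language on 0/1-labelled oriented paths is thus given by a set $W$ of binary words, and it is Turing-computable if $W$ is decidable. **Theorem.** There exists a Turing-computable language $L$ on 0/1-labelled oriented paths that is outside $\mathsf{LH}$, even if protocols need to be correct on 0/1-labelled oriented paths only: for every class $\mathcal C$ of instances that contains all 0/1-labelled oriented paths, $L$ is not in $\mathsf{LH}$ over $\mathcal C$. -/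

import Mathlib

/-- A network with a local input at every node.  Identities are positive integers, pairwise distinct
in a network, so each node *is* its identity: a graph together with an identity assignment is a
graph whose vertex set is a finite set of positive integers.  Networks are connected (in particular
they have at least one node). -/
structure Network where
  nodes : Finset ℕ
  one_le : ∀ v ∈ nodes, 1 ≤ v
  graph : SimpleGraph nodes
  connected : graph.Connected
  input : nodes → ℕ

namespace Network

/-- The number `n` of nodes. -/
def size (I : Network) : ℕ := I.nodes.card

/-- A labelling assigns a bit string to each node. -/
abbrev Labelling (I : Network) : Type := I.nodes → List Bool

/-- Every label consists of at most `c log n` bits. -/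
def Labelling.BoundedBy {I : Network} (ℓ : I.Labelling) (c : ℝ) : Prop :=
  ∀ v, ((ℓ v).length : ℝ) ≤ c * Real.logb 2 I.size

/-- The nodes at distance at most `t` from `v`, in increasing order of identities. -/
noncomputable def ballNodes (I : Network) (v : I.nodes) (t : ℕ) : List I.nodes :=
  (Finset.univ.filter fun u => I.graph.dist v u ≤ t).sort (· ≤ ·)

end Network

/-- Finite data describing a labelled local neighbourhood: the identity of the centre, and for each
node of the neighbourhood its identity, its input, its labels `ℓ₁, …, ℓₖ`, and the identities of
its neighbours inside the neighbourhood. -/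
abbrev View : Type := ℕ × List (ℕ × ℕ × List (List Bool) × List ℕ)

open Classical in
/-- The labelled neighbourhood `B_G(v,t)` (induced subgraph) as seen by `v`. -/
noncomputable def Network.view (I : Network) (v : I.nodes) (t : ℕ) (ls : List I.Labelling) : View :=
  ((v : ℕ), (I.ballNodes v t).map fun (u : I.nodes) =>
    ((u : ℕ), I.input u, ls.map fun ℓ => ℓ u,
      ((I.ballNodes v t).filter fun (w : I.nodes) => I.graph.Adj u w).map fun (w : I.nodes) => (w : ℕ)))

/-- The algorithm `A`, run for `t` rounds, accepts: every node accepts. -/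
def Accepts (A : View → Bool) (t : ℕ) (I : Network) (ls : List I.Labelling) : Prop :=
  ∀ v : I.nodes, A (I.view v t ls) = true

/-- `Alternates I c b k P` is the statement `Q₁ ℓ₁, Q₂ ℓ₂, …, Qₖ ℓₖ, P [ℓ₁, …, ℓₖ]`, where the
`ℓᵢ` range over the labellings of size at most `c log n`, the quantifiers alternate, and the first
one is existential if `b = true` and universal if `b = false`. -/
def Alternates (I : Network) (c : ℝ) : Bool → ℕ → (List I.Labelling → Prop) → Prop
  | _, 0, P => P []
  | true, k + 1, P =>
      ∃ ℓ : I.Labelling, ℓ.BoundedBy c ∧ Alternates I c false k fun ls => P (ℓ :: ls)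
  | false, k + 1, P =>
      ∀ ℓ : I.Labelling, ℓ.BoundedBy c → Alternates I c true k fun ls => P (ℓ :: ls)

/-- The languages decided at level `k`, over the instances in `C`, by a computable local algorithm
`A` with a constant number `t` of rounds and labels of at most `c log n` bits, the first quantifier
being given by `b`. -/
def Level (C : Set Network) (b : Bool) (k : ℕ) : Set (Set Network) :=
  {L | ∃ c : ℝ, 0 ≤ c ∧ ∃ t : ℕ, ∃ A : View → Bool, Computable A ∧
    ∀ I ∈ C, I ∈ L ↔ Alternates I c b k (Accepts A t I)}

/-- The class `Σ_k` over the instances in `C`. -/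
def SigmaLD (C : Set Network) (k : ℕ) : Set (Set Network) := Level C true k

/-- The class `Π_k` over the instances in `C`. -/
def PiLD (C : Set Network) (k : ℕ) : Set (Set Network) := Level C false k

open Classical in
/-- The class `Λ_k`: it is `Σ_k` for odd `k` and `Π_k` for even `k`. -/
noncomputable def LambdaLD (C : Set Network) (k : ℕ) : Set (Set Network) :=
  if Odd k then SigmaLD C k else PiLD C k

/-- The local hierarchy over the instances in `C`. It gets smaller as `C` grows, since a protocol
has to be correct on every instance in `C`. -/
def LH (C : Set Network) : Set (Set Network) := ⋃ k : ℕ, LambdaLD C k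

/-- A 0/1-labelled oriented path: the nodes have the consecutive identities `1, …, n` along the
path, and the inputs are `0` or `1`. -/
structure Network.IsBinaryOrientedPath (I : Network) : Prop where
  nodes_eq : I.nodes = Finset.Icc 1 I.size
  adj_iff : ∀ u v : I.nodes, I.graph.Adj u v ↔ (u : ℕ) + 1 = v ∨ (v : ℕ) + 1 = u
  input_eq : ∀ v, I.input v = 0 ∨ I.input v = 1

/-- The inputs read in increasing order of identities, as bits. -/
def Network.word (I : Network) : List Bool :=
  ((Finset.univ : Finset I.nodes).sort (· ≤ ·)).map fun v => decide (I.input v = 1)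

/-- All 0/1-labelled oriented paths. -/
def binaryOrientedPaths : Set Network := {I | I.IsBinaryOrientedPath}

/-- The language on 0/1-labelled oriented paths that is given by a set of words. -/
def pathLanguage (W : Set (List Bool)) : Set Network :=
  {I | I.IsBinaryOrientedPath ∧ I.word ∈ W}

/-! ### Bounded quantifiers and primitive recursive predicates -/

/-! The proof counts, then diagonalises. Fix `k`, `t` and `c`. On the paths with `n` nodes a node
sees its identity and at most `2t+1` inputs and labels per labelling, and a label takes at most `b =
n ^ (⌈c⌉₊ + 1)` values. So only polynomially many views occur, and a local algorithm acts there as a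
table of polynomially many bits, whatever the inputs are (`exists_table_of_algorithm`). For large
`n` a table has fewer than `2 ^ n` bits (`eventually_tableSize_lt`), so there are fewer tables than
sets of words of length `n`, and some set is given by no table.

Evaluating a table is a finite alternating game, primitive recursive in all parameters, so the least
such set can be found by exhaustive search (`exists_computablePred_not_described`). One length
defeats all protocols with given `k`, `t` and label bound; hence each length can encode its own
parameters, and a single decidable `W` defeats all of them
(`exists_computablePred_not_tableAccepts`). Only paths are used, so the class `C` may be any larger
one. -/

theorem PrimrecRel.exists_lt_of_primrec {α : Type*} [Primcodable α] {R : α → ℕ → Prop} {f : α → ℕ}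
    (hR : PrimrecRel R) (hf : Primrec f) : PrimrecPred fun a => ∃ x < f a, R a x :=
  (hR.swap.exists_mem_list.comp (Primrec.list_range.comp hf) Primrec.id).of_eq fun a => by
    simp [Function.swap]

theorem PrimrecRel.forall_lt_of_primrec {α : Type*} [Primcodable α] {R : α → ℕ → Prop} {f : α → ℕ}
    (hR : PrimrecRel R) (hf : Primrec f) : PrimrecPred fun a => ∀ x < f a, R a x :=
  (hR.swap.forall_mem_list.comp (Primrec.list_range.comp hf) Primrec.id).of_eq fun a => by
    simp [Function.swap]

theorem Primrec.nat_pow : Primrec₂ ((· ^ ·) : ℕ → ℕ → ℕ) :=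
  Primrec₂.unpaired'.1 Nat.Primrec.pow

theorem PrimrecPred.iff {α : Type*} [Primcodable α] {p q : α → Prop} (hp : PrimrecPred p)
    (hq : PrimrecPred q) : PrimrecPred fun a => (p a ↔ q a) :=
  ((hp.and hq).or (hp.not.and hq.not)).of_eq fun a => by tauto

/-! ### Binary words and their codes -/

/-- The `i`-th binary digit of `S` is one. -/
def HasBit (S i : ℕ) : Prop := S / 2 ^ i % 2 = 1

instance (S i : ℕ) : Decidable (HasBit S i) := inferInstanceAs (Decidable (_ = _))

theorem primrecRel_hasBit : PrimrecRel HasBit :=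
  Primrec.eq.comp (Primrec.nat_mod.comp (Primrec.nat_div.comp Primrec.fst
    (Primrec.nat_pow.comp (Primrec.const 2) Primrec.snd)) (Primrec.const 2)) (Primrec.const 1)

/-- Every set of numbers below `m` is the set of positions of the ones of a number below `2 ^ m`. -/
theorem exists_hasBit_iff (m : ℕ) (p : ℕ → Prop) :
    ∃ S < 2 ^ m, ∀ i < m, HasBit S i ↔ p i := by
  classical
  let f : Fin m → Fin 2 := fun i => if p i then 1 else 0
  refine ⟨finFunctionFinEquiv f, (finFunctionFinEquiv f).2, fun i hi => ?_⟩
  have h := congrArg Fin.val (congrFun (finFunctionFinEquiv.symm_apply_apply f) ⟨i, hi⟩)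
  -- The inverse of `finFunctionFinEquiv` extracts digits by definition.
  have h' : (finFunctionFinEquiv f : ℕ) / 2 ^ i % 2 = (f ⟨i, hi⟩ : ℕ) := h
  unfold HasBit
  rw [h']
  by_cases hp : p i <;> simp [f, hp]

/-- The `n` lowest binary digits of `x`, least significant digit first. -/
def bitWord (n x : ℕ) : List Bool := (List.range n).map fun i => decide (HasBit x i)

/-- The number with the given binary digits, least significant digit first. -/
def wordCode (w : List Bool) : ℕ := w.foldr (fun b a => b.toNat + 2 * a) 0

theorem bitWord_succ (n x : ℕ) :
    bitWord (n + 1) x = decide (x % 2 = 1) :: bitWord n (x / 2) := by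
  simp only [bitWord, List.range_succ_eq_map, List.map_cons, List.map_map, HasBit, pow_zero,
    Nat.div_one]
  congr 1
  refine List.map_congr_left fun i _ => ?_
  simp [Nat.pow_succ', Nat.div_div_eq_div_mul]

theorem wordCode_bitWord (n x : ℕ) (hx : x < 2 ^ n) : wordCode (bitWord n x) = x := by
  induction n generalizing x with
  | zero => simp [bitWord, wordCode]; simp at hx; omega
  | succ n ih =>
    have h := ih (x / 2) (by rw [pow_succ] at hx; omega)
    rw [bitWord_succ]
    change (decide (x % 2 = 1)).toNat + 2 * wordCode (bitWord n (x / 2)) = x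
    rw [h]
    rcases Nat.mod_two_eq_zero_or_one x with h0 | h0 <;> simp [h0] <;> omega

theorem length_bitWord (n x : ℕ) : (bitWord n x).length = n := by simp [bitWord]

theorem primrec_wordCode : Primrec wordCode :=
  Primrec.list_foldr Primrec.id (Primrec.const 0) <| Primrec.to₂ <|
    Primrec.nat_add.comp ((Primrec.dom_bool Bool.toNat).comp (Primrec.fst.comp Primrec.snd))
      (Primrec.nat_mul.comp (Primrec.const 2) (Primrec.snd.comp Primrec.snd))

/-! ### Diagonalisation against sets with short descriptions -/

/-- If the sets of words of length `n` described by fewer than `2 ^ n` bits are uniformly primitive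
recursive, then some decidable set of words has no such description at any length. -/
theorem exists_computablePred_not_described (D : ℕ × ℕ → ℕ → Prop) (hD : PrimrecRel D) (M : ℕ → ℕ)
    (hM : Primrec M) :
    ∃ W : Set (List Bool), ComputablePred (fun w : List Bool => w ∈ W) ∧
      ∀ n, M n < 2 ^ n → ∀ T < 2 ^ M n, ∃ x < 2 ^ n, ¬(bitWord n x ∈ W ↔ D (n, T) x) := by
  classical
  -- `S` is read as the truth table of a set of words of length `n`, with one bit for each word code
  -- `x < 2 ^ n`.
  let avoids : ℕ → ℕ → Prop := fun n S =>
    ∀ T < 2 ^ M n, ∃ x < 2 ^ n, ¬(HasBit S x ↔ D (n, T) x)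
  have two_pow {α : Type} [Primcodable α] {f : α → ℕ} (hf : Primrec f) :
      Primrec fun a => 2 ^ f a := Primrec.nat_pow.comp (Primrec.const 2) hf
  have h_avoids : PrimrecRel avoids := by
    refine PrimrecRel.forall_lt_of_primrec
      (R := fun (a : ℕ × ℕ) T => ∃ x < 2 ^ a.1, ¬(HasBit a.2 x ↔ D (a.1, T) x)) ?_
      (two_pow (hM.comp Primrec.fst))
    refine PrimrecRel.exists_lt_of_primrec
      (R := fun (a : (ℕ × ℕ) × ℕ) x => ¬(HasBit a.1.2 x ↔ D (a.1.1, a.2) x)) ?_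
      (two_pow (Primrec.fst.comp Primrec.fst))
    refine PrimrecPred.not (PrimrecPred.iff ?_ ?_)
    · exact primrecRel_hasBit.comp (Primrec.snd.comp (Primrec.fst.comp Primrec.fst)) Primrec.snd
    · exact hD.comp ((Primrec.fst.comp (Primrec.fst.comp Primrec.fst)).pair
        (Primrec.snd.comp Primrec.fst)) Primrec.snd
  -- At each length `W` is the least avoiding truth table, and is empty if there is none. The bound
  -- on `S` makes the search primitive recursive.
  let W : Set (List Bool) := {w | ∃ S < 2 ^ 2 ^ w.length,
    (avoids w.length S ∧ ∀ S' < S, ¬avoids w.length S') ∧ HasBit S (wordCode w)}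
  have hW : PrimrecPred fun w => w ∈ W := by
    refine PrimrecRel.exists_lt_of_primrec (R := fun (w : List Bool) S =>
      (avoids w.length S ∧ ∀ S' < S, ¬avoids w.length S') ∧ HasBit S (wordCode w)) ?_
      (two_pow (two_pow Primrec.list_length))
    refine PrimrecPred.and (PrimrecPred.and ?_ ?_) ?_
    · exact h_avoids.comp (Primrec.list_length.comp Primrec.fst) Primrec.snd
    · refine PrimrecRel.forall_lt_of_primrec
        (R := fun (a : List Bool × ℕ) S' => ¬avoids a.1.length S') ?_ Primrec.snd
      exact PrimrecPred.not (h_avoids.comp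
        (Primrec.list_length.comp (Primrec.fst.comp Primrec.fst)) Primrec.snd)
    · exact primrecRel_hasBit.comp Primrec.snd (primrec_wordCode.comp Primrec.fst)
  obtain ⟨dec, hdec⟩ := hW
  refine ⟨W, ⟨dec, hdec.to_comp⟩, fun n hn => ?_⟩
  -- There are `2 ^ M n` descriptions but `2 ^ 2 ^ n` sets of words.
  have exists_avoids : ∃ S, S < 2 ^ 2 ^ n ∧ avoids n S := by
    let F : Fin (2 ^ M n) → Set (Fin (2 ^ n)) := fun T => {x | D (n, T) x}
    have hF : ¬Function.Surjective F := fun h => by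
      have hcard := Fintype.card_le_of_surjective F h
      rw [Fintype.card_set, Fintype.card_fin, Fintype.card_fin] at hcard
      exact absurd hcard (not_le.2 (Nat.pow_lt_pow_right one_lt_two hn))
    obtain ⟨s, hs⟩ := not_forall.1 hF
    obtain ⟨S, hS, hbit⟩ := exists_hasBit_iff (2 ^ n) fun i => ∃ h : i < 2 ^ n, ⟨i, h⟩ ∈ s
    refine ⟨S, hS, fun T hT => ?_⟩
    by_contra! hcon
    refine hs ⟨⟨T, hT⟩, Set.ext fun x => ?_⟩
    have h := (hcon x x.2).symm.trans (hbit x x.2)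
    simpa [F] using h
  have hS := Nat.find_spec exists_avoids
  have hmin : ∀ S' < Nat.find exists_avoids, ¬avoids n S' := fun S' h' ha =>
    Nat.find_min exists_avoids h' ⟨h'.trans hS.1, ha⟩
  have mem_iff : ∀ x < 2 ^ n, bitWord n x ∈ W ↔ HasBit (Nat.find exists_avoids) x := by
    intro x hx
    simp only [W, Set.mem_ofPred_eq, length_bitWord, wordCode_bitWord n x hx]
    constructor
    · rintro ⟨S, -, ⟨h1, h2⟩, h3⟩
      obtain h | h | h := lt_trichotomy S (Nat.find exists_avoids)
      · exact absurd h1 (hmin S h)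
      · rwa [← h]
      · exact absurd hS.2 (h2 _ h)
    · exact fun h => ⟨_, hS.1, ⟨hS.2, hmin⟩, h⟩
  intro T hT
  obtain ⟨x, hx, h⟩ := hS.2 T hT
  exact ⟨x, hx, by rwa [mem_iff x hx]⟩

/-! ### Alternating games over numbered moves -/

/-- The value of the game with `r` moves to come after the history `X`: each move is a number below
`B` that is appended to the history as a digit, existential and universal moves alternate, the last
move is existential, and the outcome is `acc`. -/
def game (B : ℕ) (acc : ℕ → Bool) : ℕ → ℕ → Bool
  | 0, X => acc X
  | r + 1, X => bif r.bodd then decide (∀ y < B, game B acc r (X * B + y) = true)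
      else decide (∃ y < B, game B acc r (X * B + y) = true)

/-- The recursive calls change the history `X` and branch `B` ways, which plain primitive recursion
does not allow. `Primrec.nat_omega_rec` does: the measure is the number of moves to come, and the
list of successor positions is computed beforehand. -/
theorem primrec_game {α : Type*} [Primcodable α] {B : α → ℕ} {acc : α → ℕ → Bool}
    (hB : Primrec B) (hacc : Primrec₂ acc) :
    Primrec₂ fun (a : α) (s : ℕ × ℕ) => game (B a) (acc a) s.1 s.2 := by
  refine Primrec.nat_omega_rec _ (m := fun _ s => s.1)
    (l := fun a s => if s.1 = 0 then [] else
      (List.range (B a)).map fun y => (s.1 - 1, s.2 * B a + y))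
    (g := fun a p => some (if p.1.1 = 0 then acc a p.1.2 else
      bif (p.1.1 - 1).bodd then decide (∀ b ∈ p.2, b = true)
        else decide (∃ b ∈ p.2, b = true)))
    (Primrec.fst.comp Primrec.snd) ?_ ?_ ?_ ?_
  · refine Primrec.ite (Primrec.eq.comp (Primrec.fst.comp Primrec.snd) (Primrec.const 0))
      (Primrec.const []) (Primrec.list_map (Primrec.list_range.comp (hB.comp Primrec.fst)) ?_)
    refine Primrec.pair
      (Primrec.nat_sub.comp (Primrec.fst.comp (Primrec.snd.comp Primrec.fst)) (Primrec.const 1))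
      (Primrec.nat_add.comp (Primrec.nat_mul.comp (Primrec.snd.comp (Primrec.snd.comp Primrec.fst))
        (hB.comp (Primrec.fst.comp Primrec.fst))) Primrec.snd)
  · have hs : Primrec fun p : α × (ℕ × ℕ) × List Bool => p.2.1.1 :=
      Primrec.fst.comp (Primrec.fst.comp Primrec.snd)
    have hl : Primrec fun p : α × (ℕ × ℕ) × List Bool => p.2.2 := Primrec.snd.comp Primrec.snd
    have htrue : PrimrecPred fun b : Bool => b = true :=
      Primrec.eq.comp Primrec.id (Primrec.const true)
    refine Primrec.option_some.comp (Primrec.ite (Primrec.eq.comp hs (Primrec.const 0))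
      (hacc.comp Primrec.fst (Primrec.snd.comp (Primrec.fst.comp Primrec.snd)))
      (Primrec.cond (Primrec.nat_bodd.comp (Primrec.nat_sub.comp hs (Primrec.const 1))) ?_ ?_))
    · exact (htrue.forall_mem_list.comp hl).decide
    · exact (htrue.exists_mem_list.comp hl).decide
  · rintro a ⟨_ | r, X⟩ s' hs'
    · simp at hs'
    · simp only [Nat.add_one_ne_zero, if_false, List.mem_map] at hs'
      obtain ⟨y, -, rfl⟩ := hs'
      simp
  · rintro a ⟨_ | r, X⟩
    · simp [game]
    · simp [game]

/-! ### Keys of local views -/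

/-- The number formed by those digits in base `b` of `x` that start at position `i`, as many as the
window of radius `t` around a node has nodes. -/
def digitWindow (b t x i : ℕ) : ℕ := x / b ^ i % b ^ (2 * t + 1)

theorem digitWindow_lt {b : ℕ} (hb : 0 < b) (t x i : ℕ) : digitWindow b t x i < b ^ (2 * t + 1) :=
  Nat.mod_lt _ (by positivity)

theorem digit_eq_of_digitWindow_eq {b t x y i j d : ℕ} (h : digitWindow b t x i = digitWindow b t y j)
    (hd : d ≤ 2 * t) : x / b ^ (i + d) % b = y / b ^ (j + d) % b := by
  have key : ∀ x i, x / b ^ (i + d) % b = digitWindow b t x i / b ^ d % b := by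
    intro x i
    have hp : b ^ (2 * t + 1) = b ^ d * b ^ (2 * t + 1 - d) := by rw [← pow_add]; congr 1; omega
    have hdvd : b ∣ b ^ (2 * t + 1 - d) := dvd_pow_self b (by omega)
    rw [digitWindow, hp, Nat.mod_mul_right_div_self, Nat.mod_mod_of_dvd _ hdvd,
      Nat.div_div_eq_div_mul, ← pow_add]
  rw [key, key, h]

/-- A number that determines all that the node at position `v` sees within distance `t` on the path
of `n` nodes with input code `x`, labelled according to `X`, `j` labellings being written in base
`b`, one digit for each node. -/
def viewKey (n b t x X v : ℕ) : ℕ → ℕ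
  -- Positions count from `0`. Near the left end `v - t` is truncated to `0`, and near the right end
  -- a window may run into the next block of digits. The surplus digits do no harm, since the key
  -- only has to determine the view.
  | 0 => v * 2 ^ (2 * t + 1) + digitWindow 2 t x (v - t)
  | j + 1 => viewKey n b t x X v j * b ^ (2 * t + 1) + digitWindow b t X (j * n + (v - t))

theorem mul_add_inj_of_lt {m a a' r r' : ℕ} (hr : r < m) (hr' : r' < m)
    (h : a * m + r = a' * m + r') : a = a' ∧ r = r' := by
  have h1 := congrArg (· / m) h
  have h2 := congrArg (· % m) h
  have hm : 0 < m := by omega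
  simp only [mul_comm _ m, Nat.mul_add_div hm, Nat.div_eq_of_lt hr, Nat.div_eq_of_lt hr',
    Nat.mul_add_mod, Nat.mod_eq_of_lt hr, Nat.mod_eq_of_lt hr'] at h1 h2
  omega

theorem eq_of_viewKey_eq {n b t x x' X X' v v' k : ℕ} (hb : 0 < b)
    (h : viewKey n b t x X v k = viewKey n b t x' X' v' k) :
    v = v' ∧ digitWindow 2 t x (v - t) = digitWindow 2 t x' (v - t) ∧
      ∀ j < k, digitWindow b t X (j * n + (v - t)) = digitWindow b t X' (j * n + (v - t)) := by
  induction k with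
  | zero =>
    obtain ⟨rfl, h2⟩ := mul_add_inj_of_lt (digitWindow_lt two_pos _ _ _)
      (digitWindow_lt two_pos _ _ _) h
    exact ⟨rfl, h2, by simp⟩
  | succ k ih =>
    obtain ⟨h1, h2⟩ := mul_add_inj_of_lt (digitWindow_lt hb _ _ _) (digitWindow_lt hb _ _ _) h
    obtain ⟨rfl, h3, h4⟩ := ih h1
    refine ⟨rfl, h3, fun j hj => ?_⟩
    obtain hj | rfl := Nat.lt_succ_iff_lt_or_eq.1 hj
    · exact h4 j hj
    · exact h2

theorem viewKey_lt {n b t x X v : ℕ} (hb : 0 < b) (hv : v < n) (k : ℕ) :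
    viewKey n b t x X v k < n * 2 ^ (2 * t + 1) * (b ^ (2 * t + 1)) ^ k := by
  have step {a m r c : ℕ} (ha : a < c) (hr : r < m) : a * m + r < c * m := by
    calc a * m + r < (a + 1) * m := by rw [add_one_mul]; omega
      _ ≤ c * m := Nat.mul_le_mul_right _ ha
  induction k with
  | zero => simpa [viewKey] using step hv (digitWindow_lt two_pos t x (v - t))
  | succ k ih =>
    rw [pow_succ (b ^ (2 * t + 1)) k, ← mul_assoc]
    exact step ih (digitWindow_lt hb _ _ _)

theorem primrec_digitWindow {α : Type*} [Primcodable α] {b t x i : α → ℕ} (hb : Primrec b)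
    (ht : Primrec t) (hx : Primrec x) (hi : Primrec i) :
    Primrec fun a => digitWindow (b a) (t a) (x a) (i a) :=
  Primrec.nat_mod.comp (Primrec.nat_div.comp hx (Primrec.nat_pow.comp hb hi))
    (Primrec.nat_pow.comp hb (Primrec.succ.comp (Primrec.nat_mul.comp (Primrec.const 2) ht)))

theorem primrec_viewKey {α : Type*} [Primcodable α] {n b t x X v k : α → ℕ} (hn : Primrec n)
    (hb : Primrec b) (ht : Primrec t) (hx : Primrec x) (hX : Primrec X) (hv : Primrec v)
    (hk : Primrec k) :
    Primrec fun a => viewKey (n a) (b a) (t a) (x a) (X a) (v a) (k a) := by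
  have hlen : Primrec fun a => 2 * t a + 1 :=
    Primrec.succ.comp (Primrec.nat_mul.comp (Primrec.const 2) ht)
  have hpos : Primrec fun a => v a - t a := Primrec.nat_sub.comp hv ht
  refine (Primrec.nat_rec' (f := k)
    (g := fun a => v a * 2 ^ (2 * t a + 1) + digitWindow 2 (t a) (x a) (v a - t a))
    (h := fun a p => p.2 * b a ^ (2 * t a + 1) +
      digitWindow (b a) (t a) (X a) (p.1 * n a + (v a - t a))) hk ?_ ?_).of_eq fun a => ?_
  · exact Primrec.nat_add.comp
      (Primrec.nat_mul.comp hv (Primrec.nat_pow.comp (Primrec.const 2) hlen))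
      (primrec_digitWindow (Primrec.const 2) ht hx hpos)
  · have lift {f : α → ℕ} (hf : Primrec f) : Primrec fun p : α × ℕ × ℕ => f p.1 :=
      hf.comp Primrec.fst
    exact Primrec.nat_add.comp
      (Primrec.nat_mul.comp (Primrec.snd.comp Primrec.snd)
        (Primrec.nat_pow.comp (lift hb) (lift hlen)))
      (primrec_digitWindow (lift hb) (lift ht) (lift hX)
        (Primrec.nat_add.comp (Primrec.nat_mul.comp (Primrec.fst.comp Primrec.snd) (lift hn))
          (lift hpos)))
  · induction k a with
    | zero => rfl
    | succ j ih => simp only [viewKey, ← ih]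

/-! ### Languages described by tables -/

/-- The protocol given by the table `T`, with `k` labellings, label codes below `b` and radius `t`,
accepts the word with code `x` on the path of `n` nodes. -/
def tableAccepts (n k b t T x : ℕ) : Bool :=
  game (b ^ n) (fun X => decide (∀ v < n, HasBit T (viewKey n b t x X v k))) k 0

/-- The number of bits of a table. -/
def tableSize (n k b t : ℕ) : ℕ := n * 2 ^ (2 * t + 1) * (b ^ (2 * t + 1)) ^ k

theorem primrec_tableAccepts {α : Type*} [Primcodable α] {n k b t T x : α → ℕ} (hn : Primrec n)
    (hk : Primrec k) (hb : Primrec b) (ht : Primrec t) (hT : Primrec T) (hx : Primrec x) :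
    Primrec fun a => tableAccepts (n a) (k a) (b a) (t a) (T a) (x a) := by
  refine (primrec_game (Primrec.nat_pow.comp hb hn) (acc := fun a X =>
    decide (∀ v < n a, HasBit (T a) (viewKey (n a) (b a) (t a) (x a) X v (k a)))) ?_).comp
      Primrec.id (hk.pair (Primrec.const 0))
  have lift {f : α → ℕ} (hf : Primrec f) : Primrec fun p : (α × ℕ) × ℕ => f p.1.1 :=
    hf.comp (Primrec.fst.comp Primrec.fst)
  refine PrimrecPred.decide (PrimrecRel.forall_lt_of_primrec
    (R := fun (a : α × ℕ) v =>
      HasBit (T a.1) (viewKey (n a.1) (b a.1) (t a.1) (x a.1) a.2 v (k a.1)))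
    ?_ (hn.comp Primrec.fst))
  exact primrecRel_hasBit.comp (lift hT) (primrec_viewKey (lift hn) (lift hb) (lift ht) (lift hx)
    (Primrec.snd.comp Primrec.fst) Primrec.snd (lift hk))

theorem primrec_tableSize {α : Type*} [Primcodable α] {n k b t : α → ℕ} (hn : Primrec n)
    (hk : Primrec k) (hb : Primrec b) (ht : Primrec t) :
    Primrec fun a => tableSize (n a) (k a) (b a) (t a) := by
  have hlen : Primrec fun a => 2 * t a + 1 :=
    Primrec.succ.comp (Primrec.nat_mul.comp (Primrec.const 2) ht)
  exact Primrec.nat_mul.comp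
    (Primrec.nat_mul.comp hn (Primrec.nat_pow.comp (Primrec.const 2) hlen))
    (Primrec.nat_pow.comp (Primrec.nat_pow.comp hb hlen) hk)

/-- With label codes polynomial in `n`, tables are shorter than `2 ^ n` for large `n`. -/
theorem eventually_tableSize_lt (k q t : ℕ) :
    ∀ᶠ n in Filter.atTop, tableSize n k (n ^ q) t < 2 ^ n := by
  -- With `b = n ^ q` the table size is `2 ^ (2 * t + 1)` times this power of `n`.
  have h := (tendsto_pow_const_div_const_pow_of_one_lt (1 + (q * (2 * t + 1)) * k)
    (one_lt_two (α := ℝ))).eventually_lt_const (u := (2 ^ (2 * t + 1) : ℝ)⁻¹) (by positivity)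
  filter_upwards [h] with n hn
  rw [div_lt_iff₀ (by positivity), ← div_eq_inv_mul, lt_div_iff₀ (by positivity)] at hn
  have : n ^ (1 + (q * (2 * t + 1)) * k) * 2 ^ (2 * t + 1) < 2 ^ n := by exact_mod_cast hn
  rw [tableSize]
  convert this using 1
  ring

/-- There is a decidable set of words that no family of tables with label codes polynomial in the
length describes. -/
theorem exists_computablePred_not_tableAccepts :
    ∃ W : Set (List Bool), ComputablePred (fun w : List Bool => w ∈ W) ∧
      ∀ k q t, ∃ n ≥ 2, ∀ T < 2 ^ tableSize n k (n ^ q) t, ∃ x < 2 ^ n,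
        ¬(bitWord n x ∈ W ↔ tableAccepts n k (n ^ q) t T x = true) := by
  -- The length `n` encodes the parameters `k`, `q`, `t` that it diagonalises against; `n.unpair.2`
  -- stays free as padding.
  let K : ℕ → ℕ := fun n => n.unpair.1.unpair.1
  let Q : ℕ → ℕ := fun n => n.unpair.1.unpair.2.unpair.1
  let R : ℕ → ℕ := fun n => n.unpair.1.unpair.2.unpair.2
  have h₁ : Primrec fun n : ℕ => n.unpair.1 := Primrec.fst.comp Primrec.unpair
  have h₂ : Primrec fun n : ℕ => n.unpair.2 := Primrec.snd.comp Primrec.unpair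
  have hK : Primrec K := h₁.comp h₁
  have hQ : Primrec Q := h₁.comp (h₂.comp h₁)
  have hR : Primrec R := h₂.comp (h₂.comp h₁)
  have hfst : Primrec fun p : (ℕ × ℕ) × ℕ => p.1.1 := Primrec.fst.comp Primrec.fst
  have hD : PrimrecRel fun (a : ℕ × ℕ) x =>
      tableAccepts a.1 (K a.1) (a.1 ^ Q a.1) (R a.1) a.2 x = true :=
    Primrec.eq.comp (primrec_tableAccepts hfst (hK.comp hfst)
      (Primrec.nat_pow.comp hfst (hQ.comp hfst)) (hR.comp hfst) (Primrec.snd.comp Primrec.fst)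
      Primrec.snd) (Primrec.const true)
  obtain ⟨W, hW, h⟩ := exists_computablePred_not_described _ hD
    (fun n => tableSize n (K n) (n ^ Q n) (R n))
    (primrec_tableSize Primrec.id hK (Primrec.nat_pow.comp Primrec.id hQ) hR)
  refine ⟨W, hW, fun k q t => ?_⟩
  obtain ⟨n₀, hn₀⟩ := Filter.eventually_atTop.1 (eventually_tableSize_lt k q t)
  -- The padding makes `n` large enough for the counting bound.
  let n := Nat.pair (Nat.pair k (Nat.pair q t)) (max n₀ 2)
  have hn : max n₀ 2 ≤ n := Nat.right_le_pair _ _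
  have hk : K n = k := by simp [K, n]
  have hq : Q n = q := by simp [Q, n]
  have ht : R n = t := by simp [R, n]
  have := h n
  simp only [hk, hq, ht] at this
  exact ⟨n, (le_max_right _ _).trans hn, this (hn₀ n ((le_max_left _ _).trans hn))⟩

/-! ### Oriented paths -/

/-- The path with the nodes `1, …, n` whose inputs are the lowest `n` binary digits of `x`. -/
def pathNetwork (n : ℕ) (hn : 1 ≤ n) (x : ℕ) : Network where
  nodes := Finset.Icc 1 n
  one_le v hv := (Finset.mem_Icc.1 hv).1
  graph :=
    { Adj := fun u v => (u : ℕ) + 1 = v ∨ (v : ℕ) + 1 = u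
      symm := ⟨fun _ _ h => h.symm⟩
      loopless := ⟨fun _ h => by omega⟩ }
  connected := by
    refine SimpleGraph.connected_iff_exists_forall_reachable _ |>.2
      ⟨⟨1, Finset.mem_Icc.2 ⟨le_rfl, hn⟩⟩, ?_⟩
    rintro ⟨v, hv⟩
    induction v with
    | zero => simp at hv
    | succ v ih =>
      obtain rfl | h0 := Nat.eq_zero_or_pos v
      · exact SimpleGraph.Reachable.refl _
      · have hv' : v ∈ Finset.Icc 1 n := by simp only [Finset.mem_Icc] at hv ⊢; omega
        exact (ih hv').trans (SimpleGraph.Adj.reachable (Or.inl rfl))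
  input v := x / 2 ^ ((v : ℕ) - 1) % 2

section

variable {n : ℕ} {hn : 1 ≤ n} {x : ℕ}

theorem size_pathNetwork : (pathNetwork n hn x).size = n := by
  simp [Network.size, pathNetwork]

theorem pathNetwork_mem_binaryOrientedPaths : pathNetwork n hn x ∈ binaryOrientedPaths where
  nodes_eq := by rw [size_pathNetwork]; rfl
  adj_iff _ _ := Iff.rfl
  input_eq _ := Nat.mod_two_eq_zero_or_one _

theorem word_pathNetwork : (pathNetwork n hn x).word = bitWord n x := by
  have hsort : ((Finset.univ : Finset (Finset.Icc 1 n)).sort (· ≤ ·)).map Subtype.val =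
      (List.range n).map (· + 1) := by
    have h1 := StrictMonoOn.map_finsetSort (s := (Finset.univ : Finset (Finset.Icc 1 n)))
      (f := Function.Embedding.subtype _) fun _ _ _ _ h => h
    have h2 := StrictMonoOn.map_finsetSort (s := Finset.range n)
      (f := addRightEmbedding 1) fun a _ b _ h => by simpa using h
    have h3 : (Finset.univ : Finset (Finset.Icc 1 n)).map (Function.Embedding.subtype _) =
        (Finset.range n).map (addRightEmbedding 1) := by
      ext i
      simp only [Finset.mem_map, Finset.mem_univ, true_and, Function.Embedding.subtype_apply,
        Subtype.exists, Finset.mem_Icc, exists_prop, exists_eq_right, Finset.mem_range,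
        addRightEmbedding_apply]
      exact ⟨fun h => ⟨i - 1, by omega, by omega⟩, by rintro ⟨j, hj, rfl⟩; omega⟩
    rw [h3, ← h2, Finset.sort_range] at h1
    exact h1
  have := congrArg (List.map fun i => decide (x / 2 ^ (i - 1) % 2 = 1)) hsort
  rw [List.map_map, List.map_map] at this
  exact this

theorem pathNetwork_mem_pathLanguage {W : Set (List Bool)} :
    pathNetwork n hn x ∈ pathLanguage W ↔ bitWord n x ∈ W := by
  rw [← word_pathNetwork (hn := hn)]
  exact and_iff_right pathNetwork_mem_binaryOrientedPaths

/-- An edge changes the identity by one. This bound alone places the ball of radius `t` inside the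
window of `2t+1` positions. -/
theorem le_add_dist_pathNetwork (u v : (pathNetwork n hn x).nodes) :
    (u : ℕ) ≤ v + (pathNetwork n hn x).graph.dist v u ∧
      (v : ℕ) ≤ u + (pathNetwork n hn x).graph.dist v u := by
  have walk {u v : (pathNetwork n hn x).nodes} (p : (pathNetwork n hn x).graph.Walk v u) :
      (u : ℕ) ≤ v + p.length ∧ (v : ℕ) ≤ u + p.length := by
    induction p with
    | nil => simp
    | cons h p ih =>
      rw [SimpleGraph.Walk.length_cons]
      have h' := h
      simp only [pathNetwork] at h'
      omega
  obtain ⟨p, hp⟩ := (pathNetwork n hn x).connected.exists_walk_length_eq_dist v u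
  rw [← hp]
  exact walk p

end

/-! ### Codes of labellings -/

theorem exists_bounded_string_decoding {s N : ℕ} (h : 2 ^ (s + 1) ≤ N) :
    ∃ dec : ℕ → List Bool, (∀ m, (dec m).length ≤ s) ∧
      ∀ l : List Bool, l.length ≤ s → ∃ m < N, dec m = l := by
  classical
  -- The initial value `1` marks the end of the string, so strings that differ only in trailing
  -- zeros get different codes.
  let enc : List Bool → ℕ := fun l => l.foldr (fun b a => b.toNat + 2 * a) 1
  have enc_cons (b : Bool) (l : List Bool) : enc (b :: l) = b.toNat + 2 * enc l := rfl
  have enc_pos (l : List Bool) : 1 ≤ enc l := by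
    induction l with
    | nil => exact le_rfl
    | cons b l ih => rw [enc_cons]; omega
  have enc_lt (l : List Bool) : enc l < 2 ^ (l.length + 1) := by
    induction l with
    | nil => simp [enc]
    | cons b l ih =>
      rw [enc_cons, List.length_cons, pow_succ]
      have := Bool.toNat_le b
      omega
  have enc_inj : Function.Injective enc := by
    intro l
    induction l with
    | nil =>
      rintro (_ | ⟨b, l'⟩) hl
      · rfl
      · have := enc_pos l'
        rw [enc_cons] at hl
        change 1 = _ at hl
        omega
    | cons a l ih =>
      rintro (_ | ⟨b, l'⟩) hl
      · have := enc_pos l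
        rw [enc_cons] at hl
        change _ = 1 at hl
        omega
      · rw [enc_cons, enc_cons] at hl
        have ha := Bool.toNat_le a
        have hb := Bool.toNat_le b
        have htail : enc l = enc l' := by omega
        have hhead : a.toNat = b.toNat := by omega
        rw [ih htail, show a = b by cases a <;> cases b <;> simp_all]
  -- Numbers that encode no short string decode to `[]`. Every number thus gives a legal label, and
  -- moves of the game need no validity check.
  refine ⟨fun m => if h : ∃ l : List Bool, l.length ≤ s ∧ enc l = m then h.choose else [],
    fun m => ?_, fun l hl => ⟨enc l, ?_, ?_⟩⟩
  · dsimp only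
    split_ifs with hm
    · exact hm.choose_spec.1
    · exact Nat.zero_le _
  · exact (enc_lt l).trans_le ((Nat.pow_le_pow_right two_pos (by omega)).trans h)
  · have hm : ∃ l' : List Bool, l'.length ≤ s ∧ enc l' = enc l := ⟨l, hl, rfl⟩
    dsimp only
    rw [dif_pos hm]
    exact enc_inj hm.choose_spec.2

/-- `2 ^ (c * logb 2 n) = n ^ c`; the extra factor `2` is paid for by `2 ≤ n`. -/
theorem two_pow_floor_mul_logb_le {c : ℝ} (hc : 0 ≤ c) {n : ℕ} (hn : 2 ≤ n) :
    2 ^ (⌊c * Real.logb 2 n⌋₊ + 1) ≤ n ^ (⌈c⌉₊ + 1) := by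
  have hn1 : (1 : ℝ) ≤ n := by exact_mod_cast (by omega : 1 ≤ n)
  have hlog : 0 ≤ c * Real.logb 2 n := mul_nonneg hc (Real.logb_nonneg one_lt_two hn1)
  have h : (2 : ℝ) ^ ⌊c * Real.logb 2 n⌋₊ ≤ (n : ℝ) ^ ⌈c⌉₊ := by
    calc (2 : ℝ) ^ ⌊c * Real.logb 2 n⌋₊ = (2 : ℝ) ^ (⌊c * Real.logb 2 n⌋₊ : ℝ) :=
          (Real.rpow_natCast _ _).symm
      _ ≤ (2 : ℝ) ^ (c * Real.logb 2 n) :=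
          Real.rpow_le_rpow_of_exponent_le one_le_two (Nat.floor_le hlog)
      _ = (n : ℝ) ^ c := by
          rw [mul_comm, Real.rpow_mul zero_le_two, Real.rpow_logb two_pos (by norm_num) (by positivity)]
      _ ≤ (n : ℝ) ^ (⌈c⌉₊ : ℝ) := Real.rpow_le_rpow_of_exponent_le hn1 (Nat.le_ceil c)
      _ = (n : ℝ) ^ ⌈c⌉₊ := Real.rpow_natCast _ _
  have h' : 2 ^ ⌊c * Real.logb 2 n⌋₊ ≤ n ^ ⌈c⌉₊ := by exact_mod_cast h
  rw [pow_succ, pow_succ]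
  exact Nat.mul_le_mul h' hn

/-! ### Alternating quantifiers as games -/

/-- The labellings recorded by the history `X` of `m` moves below `B`, the earliest first. -/
def historyLabellings {I : Network} (B : ℕ) (lab : ℕ → I.Labelling) : ℕ → ℕ → List I.Labelling
  | 0, _ => []
  | m + 1, X => historyLabellings B lab m (X / B) ++ [lab (X % B)]

theorem historyLabellings_succ {I : Network} {B : ℕ} (lab : ℕ → I.Labelling) (m X : ℕ) {y : ℕ}
    (hy : y < B) :
    historyLabellings B lab (m + 1) (X * B + y) = historyLabellings B lab m X ++ [lab y] := by
  have hB : 0 < B := by omega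
  rw [historyLabellings, mul_comm X, Nat.mul_add_div hB, Nat.div_eq_of_lt hy, Nat.mul_add_mod,
    Nat.mod_eq_of_lt hy, add_zero]

/-- By `hlab` the moves below `B` enumerate exactly the bounded labellings, so quantifiers match one
by one. The first one is given by `r.bodd` because the last one is existential, as in `Λ_k`. -/
theorem game_eq_true_iff_alternates {I : Network} {B k : ℕ} {c : ℝ} {lab : ℕ → I.Labelling}
    (hlab : ∀ ℓ : I.Labelling, ℓ.BoundedBy c ↔ ∃ y < B, lab y = ℓ) {acc : ℕ → Bool}
    {P : List I.Labelling → Prop}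
    (hacc : ∀ X, acc X = true ↔ P (historyLabellings B lab k X)) (r m X : ℕ) (hk : m + r = k) :
    game B acc r X = true ↔
      Alternates I c r.bodd r fun ls => P (historyLabellings B lab m X ++ ls) := by
  induction r generalizing m X with
  | zero =>
    subst hk
    simpa [game, Alternates] using hacc X
  | succ r ih =>
    have step : ∀ y < B, game B acc r (X * B + y) = true ↔
        Alternates I c r.bodd r fun ls => P (historyLabellings B lab m X ++ lab y :: ls) := by
      intro y hy
      rw [ih (m + 1) _ (by omega), historyLabellings_succ lab m X hy]
      simp only [List.append_assoc, List.singleton_append]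
    rw [Nat.bodd_succ]
    cases hr : r.bodd <;> rw [hr] at step
    · simp only [game, hr, cond_false, decide_eq_true_eq, Bool.not_false, Alternates, hlab]
      constructor
      · rintro ⟨y, hy, h⟩
        exact ⟨lab y, ⟨y, hy, rfl⟩, (step y hy).1 h⟩
      · rintro ⟨_, ⟨y, hy, rfl⟩, h⟩
        exact ⟨y, hy, (step y hy).2 h⟩
    · simp only [game, hr, cond_true, decide_eq_true_eq, Bool.not_true, Alternates, hlab]
      constructor
      · rintro h _ ⟨y, hy, rfl⟩
        exact (step y hy).1 (h y hy)
      · exact fun h y hy => (step y hy).2 (h _ ⟨y, hy, rfl⟩)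

/-! ### Views on paths -/

/-- The labelling of a network whose label at node `v` is encoded by the digit of `y` at position
`v - 1` in base `b`. -/
def digitLabelling (I : Network) (dec : ℕ → List Bool) (b y : ℕ) : I.Labelling :=
  fun v => dec (y / b ^ ((v : ℕ) - 1) % b)

theorem digit_mod_pow (b n y : ℕ) {i : ℕ} (hi : i < n) : y % b ^ n / b ^ i % b = y / b ^ i % b := by
  obtain ⟨d, rfl⟩ := Nat.exists_eq_add_of_lt hi
  rw [show i + d + 1 = i + (d + 1) by omega, pow_add, Nat.mod_mul_right_div_self,
    Nat.mod_mod_of_dvd _ (dvd_pow_self b (by omega))]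

/-- In base `b`, the history consists of `k` blocks of `n` digits, the latest labelling being the
lowest block; the label of `v` is the digit at offset `v - 1` in each. -/
theorem historyLabellings_map_eq {I I' : Network} (dec : ℕ → List Bool) {b n k X X' : ℕ}
    {v : I.nodes} {v' : I'.nodes} (hv : (v : ℕ) - 1 < n) (hvv : (v : ℕ) = v')
    (h : ∀ j < k, X / b ^ (j * n + ((v : ℕ) - 1)) % b = X' / b ^ (j * n + ((v : ℕ) - 1)) % b) :
    ((historyLabellings (b ^ n) (digitLabelling I dec b) k X).map fun ℓ => ℓ v) =
      (historyLabellings (b ^ n) (digitLabelling I' dec b) k X').map fun ℓ => ℓ v' := by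
  induction k generalizing X X' with
  | zero => rfl
  | succ k ih =>
    simp only [historyLabellings, List.map_append, List.map_cons, List.map_nil, digitLabelling]
    rw [ih, ← hvv, digit_mod_pow b n X hv, digit_mod_pow b n X' hv]
    · have h0 := h 0 k.succ_pos
      rw [zero_mul, zero_add] at h0
      rw [h0]
    · intro j hj
      have hj' := h (j + 1) (by omega)
      rw [show (j + 1) * n + ((v : ℕ) - 1) = n + (j * n + ((v : ℕ) - 1)) by ring] at hj'
      rwa [Nat.div_div_eq_div_mul, Nat.div_div_eq_div_mul, ← pow_add]

/-- This makes tables well defined: the verdict of an algorithm factors through the key, even across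
different inputs and histories. -/
theorem view_pathNetwork_congr {n : ℕ} {hn : 1 ≤ n} (dec : ℕ → List Bool) {b t k x x' X X' : ℕ}
    (hb : 0 < b) (v : Finset.Icc 1 n)
    (h : viewKey n b t x X ((v : ℕ) - 1) k = viewKey n b t x' X' ((v : ℕ) - 1) k) :
    (pathNetwork n hn x).view v t
        (historyLabellings (b ^ n) (digitLabelling (pathNetwork n hn x) dec b) k X) =
      (pathNetwork n hn x').view v t
        (historyLabellings (b ^ n) (digitLabelling (pathNetwork n hn x') dec b) k X') := by
  obtain ⟨-, h2, h3⟩ := eq_of_viewKey_eq hb h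
  -- The graph does not depend on `x`, so balls and adjacency agree definitionally; only inputs and
  -- labels remain.
  refine Prod.ext rfl (List.map_congr_left fun u hu => ?_)
  have hdist : (pathNetwork n hn x).graph.dist v u ≤ t := by
    simpa [Network.ballNodes] using hu
  have hle := le_add_dist_pathNetwork (hn := hn) (x := x) u v
  have hu' := Finset.mem_Icc.1 u.2
  have hv' := Finset.mem_Icc.1 v.2
  obtain ⟨d, hd, hpos⟩ : ∃ d ≤ 2 * t, (u : ℕ) - 1 = (v : ℕ) - 1 - t + d :=
    ⟨(u : ℕ) - 1 - ((v : ℕ) - 1 - t), by omega, by omega⟩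
  refine Prod.ext rfl (Prod.ext ?_ (Prod.ext ?_ rfl))
  · change x / 2 ^ ((u : ℕ) - 1) % 2 = x' / 2 ^ ((u : ℕ) - 1) % 2
    rw [hpos]
    exact digit_eq_of_digitWindow_eq h2 hd
  · refine historyLabellings_map_eq dec (by omega) rfl fun j hj => ?_
    rw [hpos, ← add_assoc]
    exact digit_eq_of_digitWindow_eq (h3 j hj) hd

theorem boundedBy_iff_exists_digitLabelling {n : ℕ} {hn : 1 ≤ n} {x b : ℕ} {c : ℝ} (hc : 0 ≤ c)
    {dec : ℕ → List Bool} (hdec : ∀ m, (dec m).length ≤ ⌊c * Real.logb 2 n⌋₊)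
    (hsurj : ∀ l : List Bool, l.length ≤ ⌊c * Real.logb 2 n⌋₊ → ∃ m < b, dec m = l)
    (ℓ : (pathNetwork n hn x).Labelling) :
    ℓ.BoundedBy c ↔ ∃ y < b ^ n, digitLabelling (pathNetwork n hn x) dec b y = ℓ := by
  have hlog : 0 ≤ c * Real.logb 2 n :=
    mul_nonneg hc (Real.logb_nonneg one_lt_two (by exact_mod_cast hn))
  have hbound : ℓ.BoundedBy c ↔ ∀ v, (ℓ v).length ≤ ⌊c * Real.logb 2 n⌋₊ := by
    simp only [Network.Labelling.BoundedBy, size_pathNetwork, Nat.le_floor_iff hlog]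
  rw [hbound]
  constructor
  · intro h
    choose m hm hdm using fun v => hsurj (ℓ v) (h v)
    let f : Fin n → Fin b := fun i => ⟨m ⟨i + 1, Finset.mem_Icc.2 ⟨by omega, by omega⟩⟩, hm _⟩
    refine ⟨finFunctionFinEquiv f, (finFunctionFinEquiv f).2, funext fun v => ?_⟩
    have hv := Finset.mem_Icc.1 v.2
    have hf := congrArg Fin.val
      (congrFun (finFunctionFinEquiv.symm_apply_apply f) ⟨(v : ℕ) - 1, by omega⟩)
    have hf' : (finFunctionFinEquiv f : ℕ) / b ^ ((v : ℕ) - 1) % b = m v := by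
      refine Eq.trans hf ?_
      change m _ = m v
      congr 1
      exact Subtype.ext (Nat.sub_add_cancel hv.1)
    rw [digitLabelling, hf', hdm]
  · rintro ⟨y, -, rfl⟩ v
    exact hdec _

/-- On the paths with `n` nodes, a local protocol is given by a table. -/
theorem exists_table_of_algorithm {n : ℕ} (hn : 2 ≤ n) {c : ℝ} (hc : 0 ≤ c) (k t : ℕ)
    (A : View → Bool) :
    ∃ T < 2 ^ tableSize n k (n ^ (⌈c⌉₊ + 1)) t, ∀ x,
      tableAccepts n k (n ^ (⌈c⌉₊ + 1)) t T x = true ↔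
        Alternates (pathNetwork n (by omega) x) c k.bodd k
          (Accepts A t (pathNetwork n (by omega) x)) := by
  have hn1 : 1 ≤ n := by omega
  set b := n ^ (⌈c⌉₊ + 1) with hb_def
  have hb : 0 < b := by positivity
  obtain ⟨dec, hdec, hsurj⟩ := exists_bounded_string_decoding (two_pow_floor_mul_logb_le hc hn)
  let labels (x X : ℕ) : List (pathNetwork n hn1 x).Labelling :=
    historyLabellings (b ^ n) (digitLabelling (pathNetwork n hn1 x) dec b) k X
  -- A bit of the table is set if some accepted view has that key. Ranging over all inputs makes one
  -- `T` serve every `x`.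
  obtain ⟨T, hT, hbit⟩ := exists_hasBit_iff (tableSize n k b t) fun κ =>
    ∃ x X, ∃ v : Finset.Icc 1 n, viewKey n b t x X ((v : ℕ) - 1) k = κ ∧
      A ((pathNetwork n hn1 x).view v t (labels x X)) = true
  refine ⟨T, hT, fun x => ?_⟩
  refine (game_eq_true_iff_alternates (k := k) (P := Accepts A t (pathNetwork n hn1 x))
    (boundedBy_iff_exists_digitLabelling hc hdec hsurj) (fun X => ?_) k 0 0 (zero_add k)).trans ?_
  · have key (v : Finset.Icc 1 n) : HasBit T (viewKey n b t x X ((v : ℕ) - 1) k) ↔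
        A ((pathNetwork n hn1 x).view v t (labels x X)) = true := by
      have hv := Finset.mem_Icc.1 v.2
      rw [hbit _ (viewKey_lt hb (by omega) k)]
      constructor
      · rintro ⟨x', X', v', hkey, hA⟩
        have hv' := Finset.mem_Icc.1 v'.2
        have hvv : v' = v := Subtype.ext (by have := (eq_of_viewKey_eq hb hkey).1; omega)
        subst hvv
        rwa [view_pathNetwork_congr dec hb v' hkey] at hA
      · exact fun h => ⟨x, X, v, rfl, h⟩
    rw [decide_eq_true_eq]
    constructor
    · intro h v
      have hv := Finset.mem_Icc.1 v.2
      exact (key v).1 (h _ (by omega))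
    · intro h v hv
      exact (key ⟨v + 1, Finset.mem_Icc.2 ⟨by omega, by omega⟩⟩).2 (h _)
  · simp [historyLabellings]

/-- There is a Turing-computable language on 0/1-labelled oriented paths outside the local hierarchy,
whatever class `C` of instances containing all these paths the protocols have to be correct on. -/
theorem mainTheorem6 :
    ∃ W : Set (List Bool), ComputablePred (fun w : List Bool => w ∈ W) ∧
      ∀ C : Set Network, binaryOrientedPaths ⊆ C → pathLanguage W ∉ LH C := by
  obtain ⟨W, hW, hdiag⟩ := exists_computablePred_not_tableAccepts
  refine ⟨W, hW, fun C hC hLH => ?_⟩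
  obtain ⟨k, hk⟩ := Set.mem_iUnion.1 hLH
  -- The first quantifier of `Λ_k` is existential exactly for odd `k`.
  have hlevel : pathLanguage W ∈ Level C k.bodd k := by
    unfold LambdaLD SigmaLD PiLD at hk
    simp only [Nat.odd_iff, Nat.mod_two_of_bodd] at hk
    cases hb : k.bodd <;> simpa [hb] using hk
  obtain ⟨c, hc, t, A, -, hA⟩ := hlevel
  obtain ⟨n, hn, h⟩ := hdiag k (⌈c⌉₊ + 1) t
  obtain ⟨T, hT, hTA⟩ := exists_table_of_algorithm hn hc k t A
  obtain ⟨x, -, hx⟩ := h T hT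
  refine hx ?_
  rw [hTA, ← hA _ (hC pathNetwork_mem_binaryOrientedPaths), pathNetwork_mem_pathLanguage]
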